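/- **Setting.** There are $N$ ads and $K$ displayed slots with $2\le K<N$. An allocation $\theta$ places the $N$ ads bijectively in slots $1,\dots,N$ (only slots $1,\dots,K$ are displayed); $\pi(i;\theta)$ is the slot of ad $i$ and $\alpha(m;\theta)$ the ad in slot $m$. In the ad-dependent cascade model with qualities $q_i\in(0,1]$ and continuation probabilities $c_i\in[0,1]$, the user observes slot $m\le K$ with probability $\Gamma_m(\theta)=\prod_{l<m}c_{\alpha(l;\theta)}$ (and $\Gamma_m(\theta)=0$ for $m>K$), and the social welfare at values $v\in[0,V]^N$, $V>0$, is $\mathrm{SW}(\theta,v)=\sum_{i}\Gamma_{\pi(i;\theta)}(\theta)\,q_i v_i$. In each round, for every ad $i$, a click event (probability $q_i$) and a continuation event (probability $c_i$) are drawn, all independent within and across rounds; ad $i$ is clicked iff it is displayed, the continuation events of all the ads above it occur, and its click event occurs. An online learning mechanism for $T$ rounds receives in each round a profile of reports in $[0,V]^N$; it chooses the allocation as a function of its random seed, the current reports, and the reports and clicks of the previous rounds, and charges payments that may in addition depend on all the clicks of the current round. It is *DSIC* if for every realization of the seed and of all the click and continuation events, every advertiser $i$, every value $v_i\in[0,V]$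 and all reports of the others in all rounds, reporting $v_i$ in every round maximizes the cumulative utility $\sum_{t=1}^{T}\big(v_i\,\mathbb 1\{i\text{ is clicked in round }t\}-p_{i,t}\big)$ among all sequences of reports of $i$ in $[0,V]$. Its expected social-welfare regret under $c$ and truthful reports $v$ is $$R_T^{SW}(c,v)=T\max_\theta \mathrm{SW}(\theta,v)-\mathbb E\Big[\sum_{t=1}^T\mathrm{SW}(\theta_t,v)\Big],$$ the expectation being over the click and continuation events and the seed. **Theorem.** Fix $N,K$ with $2\le K<N$, $V>0$ and (known) qualities $q\in(0,1]^N$; the $c_i$ are unknown to the mechanism. Every online learning DSIC mechanism has worst-case expected social-welfare regret $\Theta(T)$. That is, there are constants $\kappa,C>0$, depending only on $N,K,V,q$, such that for every $T$ and every (possibly randomized) online learning mechanism that is DSIC over $T$ rounds, $$R_T^{SW}(c,v)\ge \kappa\,T\ \text{ for some } c\in[0,1]^N,\ v\in[0,V]^N,\qquad\text{and}\qquad R_T^{SW}(c,v)\le C\,T\ \text{ for all } c\in[0,1]^N,\ v\in[0,V]^N .$$ -/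

import Mathlib

namespace SponsoredSearch

/-- An allocation `θ` of the `N` ads to the extended slots `0, …, N - 1` (top to bottom):
`θ m` is the ad `α(m; θ)` in slot `m` and `θ.symm i` is the slot `π(i; θ)` of ad `i`.
Only the slots `m < K` are displayed. -/
abbrev Allocation (N : ℕ) := Equiv.Perm (Fin N)

/-- The cumulative probability `Γ_m(θ)` that a user observes the ad in slot `m`, in the
ad-dependent cascade model with continuation probabilities `c` and `K` displayed slots. -/
noncomputable def obsProb {N : ℕ} (K : ℕ) (c : Fin N → ℝ) (θ : Allocation N) (m : Fin N) : ℝ :=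
  if (m : ℕ) < K then ∏ l ∈ Finset.univ.filter (fun l => l < m), c (θ l) else 0

/-- The social welfare `SW(θ, v) = ∑ i, Γ_{π(i;θ)}(θ) q_i v_i`. -/
noncomputable def socialWelfare {N : ℕ} (K : ℕ) (q c v : Fin N → ℝ) (θ : Allocation N) : ℝ :=
  ∑ i, obsProb K c θ (θ.symm i) * q i * v i

/-- The social welfare of an efficient allocation. -/
noncomputable def optWelfare {N : ℕ} (K : ℕ) (q c v : Fin N → ℝ) : ℝ :=
  Finset.univ.sup' Finset.univ_nonempty (socialWelfare K q c v)

/-- A realization of the behaviour of the user of one round: `u.1 i` tells whether the user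
clicks ad `i` if she observes it, and `u.2 i` whether she goes on to the next slot after having
observed ad `i`. -/
abbrev User (N : ℕ) := (Fin N → Bool) × (Fin N → Bool)

/-- The clicks that the user `u` produces on allocation `θ`: ad `i` is clicked iff it is displayed,
the user goes on after every ad above it, and she clicks `i` when she observes it. -/
def clicks {N : ℕ} (K : ℕ) (θ : Allocation N) (u : User N) (i : Fin N) : Bool :=
  decide ((θ.symm i : ℕ) < K ∧ (∀ l, l < θ.symm i → u.2 (θ l) = true) ∧ u.1 i = true)

/-- The probability that a Bernoulli variable of parameter `p` takes the value `b`. -/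
noncomputable def bern (p : ℝ) (b : Bool) : ℝ := if b then p else 1 - p

/-- The probability of a sequence of `T` users: all the click events (of probability `q i`) and
all the continuation events (of probability `c i`) are independent. -/
noncomputable def userProb {N T : ℕ} (q c : Fin N → ℝ) (ω : Fin T → User N) : ℝ :=
  ∏ t, ∏ i, bern (q i) ((ω t).1 i) * bern (c i) ((ω t).2 i)

/-- What the mechanism has seen: for each past round, the profile of reported values and the
clicks on the ads. (The past allocations are determined by these and by the seed.) -/
abbrev History (N : ℕ) := List ((Fin N → ℝ) × (Fin N → Bool))

/-- An online learning mechanism for `N` ads, with seed (internal randomness) in `S`. In each round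
it allocates the ads on the basis of the history and the current reports, and charges payments
(`pay s h r x i` is what ad `i` pays) that can also depend on all the clicks `x` of the round. -/
structure OnlineMechanism (N : ℕ) (S : Type*) [MeasurableSpace S] where
  alloc : S → History N → (Fin N → ℝ) → Allocation N
  pay : S → History N → (Fin N → ℝ) → (Fin N → Bool) → Fin N → ℝ
  measurableSet_alloc : ∀ h r θ, MeasurableSet {s | alloc s h r = θ}

namespace OnlineMechanism

variable {N T : ℕ} {S : Type*} [MeasurableSpace S]

/-- The history before round `t` (rounds are `0, …, T - 1`), for seed `s`, when `b t i` is the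
value that ad `i` reports in round `t` and the users are `ω`. -/
def history (M : OnlineMechanism N S) (K : ℕ) (s : S) (b : Fin T → Fin N → ℝ)
    (ω : Fin T → User N) : (t : ℕ) → t ≤ T → History N
  | 0, _ => []
  | t + 1, h =>
    let past := M.history K s b ω t (Nat.le_of_succ_le h)
    past ++ [(b ⟨t, h⟩, clicks K (M.alloc s past (b ⟨t, h⟩)) (ω ⟨t, h⟩))]

/-- The allocation of round `t`. -/
def allocAt (M : OnlineMechanism N S) (K : ℕ) (s : S) (b : Fin T → Fin N → ℝ)
    (ω : Fin T → User N) (t : Fin T) : Allocation N :=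
  M.alloc s (M.history K s b ω t t.2.le) (b t)

/-- The clicks of round `t`. -/
def clicksAt (M : OnlineMechanism N S) (K : ℕ) (s : S) (b : Fin T → Fin N → ℝ)
    (ω : Fin T → User N) (t : Fin T) : Fin N → Bool :=
  clicks K (M.allocAt K s b ω t) (ω t)

/-- The payment of ad `i` in round `t`. -/
def payAt (M : OnlineMechanism N S) (K : ℕ) (s : S) (b : Fin T → Fin N → ℝ)
    (ω : Fin T → User N) (t : Fin T) (i : Fin N) : ℝ :=
  M.pay s (M.history K s b ω t t.2.le) (b t) (M.clicksAt K s b ω t) i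

/-- The utility, cumulated over the `T` rounds, of advertiser `i` with value per click `x`. -/
noncomputable def utility (M : OnlineMechanism N S) (K : ℕ) (s : S) (b : Fin T → Fin N → ℝ)
    (ω : Fin T → User N) (i : Fin N) (x : ℝ) : ℝ :=
  ∑ t, ((if M.clicksAt K s b ω t i then x else 0) - M.payAt K s b ω t i)

/-- Dominant strategy incentive compatibility over the horizon `T`, a posteriori: for every seed
and every sequence of users, whatever the others report in each round, always reporting the true
value maximizes the cumulative utility. Values and reports range over `[0, V]`. -/
def DSIC (M : OnlineMechanism N S) (K T : ℕ) (V : ℝ) : Prop :=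
  ∀ (s : S) (ω : Fin T → User N) (i : Fin N), ∀ x ∈ Set.Icc 0 V,
    ∀ b : Fin T → Fin N → ℝ, (∀ t j, b t j ∈ Set.Icc 0 V) →
      M.utility K s b ω i x ≤ M.utility K s (fun t => Function.update (b t) i x) ω i x

/-- The expected regret over the social welfare, cumulated over `T` rounds with truthful reports
`v`; the expectation is over the users and over the seed. -/
noncomputable def welfareRegret (M : OnlineMechanism N S) (μ : MeasureTheory.Measure S)
    (K T : ℕ) (q c v : Fin N → ℝ) : ℝ :=
  T * optWelfare K q c v -
    ∫ s, ∑ ω : Fin T → User N, userProb q c ω *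
      ∑ t, socialWelfare K q c v (M.allocAt K s (fun _ => v) ω t) ∂μ

end OnlineMechanism

end SponsoredSearch

/-! The mechanism sees clicks but not which ads the user went past, so it cannot charge the payments
that truthfulness requires of an efficient rule. Fix a seed, the users and a round `t`, and compare
two users of round `t` who would click only ad `i`: one stops after `k`, the other after `k` or `j`;
later users never click. Let the weights (quality times value) of `j` and `k` be `4 * e` and `e`,
those of the ads other than `i` be `0`, and let the bid of `i` vary. If ads are sorted by weight,
neither user clicks when `i` bids `0` and both click when `i` has weight `5 * e`. So at both ends
the two runs have the same clicks and payments, and truthfulness ties the areas under the two click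
curves together up to a grid error (`sum_sub_le_of_truthful`). Yet wherever `i` is sorted second,
only the first user clicks. Hence at most `T` of the intermediate grid bids can be sorted
(`card_sorts_le`). When every continuation probability is `1 / 2`, an unsorted allocation loses at
least `(1 / 2) ^ N * e` (`socialWelfare_add_le_optWelfare`). With `2 * T` intermediate bids, each
round of each run therefore fails at an end or at `T` of these bids; a weighted average over the
bids (`le_sum_welfareRegret`) yields one profile with linear regret. The upper bound only uses that
welfare lies in `[0, N * V]`. -/

namespace SponsoredSearch

/-! ### Welfare, and the loss caused by unsorted allocations. -/

section Welfare

variable {N : ℕ}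

lemma obsProb_nonneg {K : ℕ} {c : Fin N → ℝ} (hc : ∀ i, c i ∈ Set.Icc (0 : ℝ) 1)
    (θ : Allocation N) (m : Fin N) : 0 ≤ obsProb K c θ m := by
  unfold obsProb
  split_ifs
  · exact Finset.prod_nonneg fun l _ => (hc _).1
  · exact le_rfl

lemma obsProb_le_one {K : ℕ} {c : Fin N → ℝ} (hc : ∀ i, c i ∈ Set.Icc (0 : ℝ) 1)
    (θ : Allocation N) (m : Fin N) : obsProb K c θ m ≤ 1 := by
  unfold obsProb
  split_ifs
  · exact Finset.prod_le_one (fun l _ => (hc _).1) fun l _ => (hc _).2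
  · exact zero_le_one

lemma socialWelfare_nonneg {K : ℕ} {q c v : Fin N → ℝ} (hq : ∀ i, 0 ≤ q i)
    (hc : ∀ i, c i ∈ Set.Icc (0 : ℝ) 1) (hv : ∀ i, 0 ≤ v i) (θ : Allocation N) :
    0 ≤ socialWelfare K q c v θ :=
  Finset.sum_nonneg fun i _ =>
    mul_nonneg (mul_nonneg (obsProb_nonneg hc θ _) (hq i)) (hv i)

lemma socialWelfare_le {K : ℕ} {q c v : Fin N → ℝ} {V : ℝ} (hq : ∀ i, q i ∈ Set.Icc (0 : ℝ) 1)
    (hc : ∀ i, c i ∈ Set.Icc (0 : ℝ) 1) (hv : ∀ i, v i ∈ Set.Icc 0 V) (θ : Allocation N) :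
    socialWelfare K q c v θ ≤ N * V := by
  have h : ∀ i ∈ Finset.univ, obsProb K c θ (θ.symm i) * q i * v i ≤ V := fun i _ => by
    have h1 : obsProb K c θ (θ.symm i) * q i ≤ 1 :=
      mul_le_one₀ (obsProb_le_one hc θ _) (hq i).1 (hq i).2
    exact (mul_le_of_le_one_left (hv i).1 h1).trans (hv i).2
  simpa [socialWelfare] using Finset.sum_le_card_nsmul _ _ _ h

lemma socialWelfare_le_optWelfare (K : ℕ) (q c v : Fin N → ℝ) (θ : Allocation N) :
    socialWelfare K q c v θ ≤ optWelfare K q c v :=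
  Finset.le_sup' (socialWelfare K q c v) (Finset.mem_univ θ)

lemma obsProb_half (K : ℕ) (θ : Allocation N) (m : Fin N) :
    obsProb K (fun _ => 1 / 2) θ m = if (m : ℕ) < K then (1 / 2 : ℝ) ^ (m : ℕ) else 0 := by
  have h : (Finset.univ.filter fun l : Fin N => l < m) = Finset.Iio m := by ext; simp
  simp [obsProb, h]

/-- A displayed ad is preceded by every ad of larger weight. -/
def Sorts (K : ℕ) (w : Fin N → ℝ) (θ : Allocation N) : Prop :=
  ∀ a b, w b < w a → (θ.symm b : ℕ) < K → θ.symm a < θ.symm b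

/-- Passing to a later slot at least halves the observation probability, so the drop is at least `(1
/ 2) ^ (m + 1)`, and `m + 1 ≤ N`. -/
lemma obsProb_half_sub {K : ℕ} (θ : Allocation N) {m m' : Fin N} (hm : (m : ℕ) < K)
    (h : m < m') :
    (1 / 2 : ℝ) ^ N ≤ obsProb K (fun _ => 1 / 2) θ m - obsProb K (fun _ => 1 / 2) θ m' := by
  have h1 : (m : ℕ) + 1 ≤ m' := h
  have h2 : obsProb K (fun _ => 1 / 2) θ m' ≤ (1 / 2 : ℝ) ^ ((m : ℕ) + 1) := by
    rw [obsProb_half]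
    split_ifs
    · exact pow_le_pow_of_le_one (by norm_num) (by norm_num) h1
    · positivity
  have h3 : (1 / 2 : ℝ) ^ N ≤ (1 / 2 : ℝ) ^ ((m : ℕ) + 1) :=
    pow_le_pow_of_le_one (by norm_num) (by norm_num) m.2
  have h4 : obsProb K (fun _ => 1 / 2) θ m = (1 / 2 : ℝ) ^ (m : ℕ) := by
    rw [obsProb_half, if_pos hm]
  rw [pow_succ] at h2 h3
  linarith

/-- When all the continuation probabilities are `1 / 2`, an allocation that does not sort the ads
by weight loses a fixed fraction of the smallest gap between weights. -/
lemma socialWelfare_add_le_optWelfare {K : ℕ} {q v : Fin N → ℝ} {e : ℝ}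
    (hgap : ∀ a b, q b * v b < q a * v a → e ≤ q a * v a - q b * v b) {θ : Allocation N}
    (hθ : ¬ Sorts K (fun a => q a * v a) θ) (he : 0 ≤ e) :
    socialWelfare K q (fun _ => 1 / 2) v θ + (1 / 2) ^ N * e
      ≤ optWelfare K q (fun _ => 1 / 2) v := by
  simp only [Sorts, not_forall, not_lt] at hθ
  obtain ⟨a, b, hw, hb, hab⟩ := hθ
  have hne : a ≠ b := by rintro rfl; exact lt_irrefl _ hw
  have hlt : θ.symm b < θ.symm a := lt_of_le_of_ne hab fun h => hne (θ.symm.injective h.symm)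
  -- Exchange the misplaced pair. Observation depends on the slot alone here, so only the terms of
  -- `a` and `b` change.
  refine le_trans ?_ (socialWelfare_le_optWelfare K q _ v (θ.trans (Equiv.swap a b)))
  have hobs : ∀ m, obsProb K (fun _ => 1 / 2) (θ.trans (Equiv.swap a b)) m
      = obsProb K (fun _ => 1 / 2) θ m := fun m => by simp only [obsProb_half]
  have hdiff : socialWelfare K q (fun _ => 1 / 2) v (θ.trans (Equiv.swap a b))
      - socialWelfare K q (fun _ => 1 / 2) v θ
      = (obsProb K (fun _ => 1 / 2) θ (θ.symm b) - obsProb K (fun _ => 1 / 2) θ (θ.symm a))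
        * (q a * v a - q b * v b) := by
    unfold socialWelfare
    rw [← Finset.sum_sub_distrib, Finset.sum_eq_add a b hne]
    · simp only [hobs, Equiv.symm_trans_apply, Equiv.symm_swap, Equiv.swap_apply_left,
        Equiv.swap_apply_right]
      ring
    · rintro d - ⟨hda, hdb⟩
      simp only [hobs, Equiv.symm_trans_apply, Equiv.symm_swap,
        Equiv.swap_apply_of_ne_of_ne hda hdb, sub_self]
    · simp
    · simp
  have h := mul_le_mul (obsProb_half_sub θ hb hlt) (hgap a b hw) he
    (sub_nonneg.2 ((sub_nonneg.1 (le_trans (by positivity) (obsProb_half_sub θ hb hlt)))))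
  linarith

end Welfare

/-! ### The law of the users. -/

section Users

variable {N T : ℕ}

lemma bern_nonneg {p : ℝ} (hp : p ∈ Set.Icc (0 : ℝ) 1) (b : Bool) : 0 ≤ bern p b := by
  cases b <;> simp [bern, hp.1, hp.2]

lemma userProb_nonneg {q c : Fin N → ℝ} (hq : ∀ i, q i ∈ Set.Icc (0 : ℝ) 1)
    (hc : ∀ i, c i ∈ Set.Icc (0 : ℝ) 1) (ω : Fin T → User N) : 0 ≤ userProb q c ω :=
  Finset.prod_nonneg fun _ _ => Finset.prod_nonneg fun i _ =>
    mul_nonneg (bern_nonneg (hq i) _) (bern_nonneg (hc i) _)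

lemma sum_prod_bern (p : Fin N → ℝ) : ∑ x : Fin N → Bool, ∏ i, bern (p i) (x i) = 1 := by
  rw [← Fintype.piFinset_univ, ← Finset.prod_univ_sum]
  simp [bern]

lemma sum_userProb (q c : Fin N → ℝ) : ∑ ω : Fin T → User N, userProb q c ω = 1 := by
  have h : ∑ u : User N, ∏ i, bern (q i) (u.1 i) * bern (c i) (u.2 i) = 1 := by
    simp_rw [Finset.prod_mul_distrib]
    rw [Fintype.sum_prod_type]
    simp_rw [← Finset.mul_sum, sum_prod_bern, mul_one]
    exact sum_prod_bern q
  unfold userProb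
  rw [← Fintype.piFinset_univ,
    ← Finset.prod_univ_sum (fun _ : Fin T => (Finset.univ : Finset (User N)))
      fun _ u => ∏ i, bern (q i) (u.1 i) * bern (c i) (u.2 i)]
  simp [h]

end Users

/-! ### Single-parameter truthfulness on a grid. -/

section SingleParameter

/-- If two single-parameter truthful rules agree at the two ends of a grid of types, the
allocation of the one exceeds that of the other by a bounded amount along the grid. -/
lemma sum_sub_le_of_truthful {n n' P P' : ℝ → ℝ} {V δ : ℝ} {G : ℕ} (hδ : 0 < δ)
    (hG : G * δ ≤ V)
    (h : ∀ x ∈ Set.Icc 0 V, ∀ y ∈ Set.Icc 0 V, x * n y - P y ≤ x * n x - P x)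
    (h' : ∀ x ∈ Set.Icc 0 V, ∀ y ∈ Set.Icc 0 V, x * n' y - P' y ≤ x * n' x - P' x)
    (hn0 : n 0 = n' 0) (hP0 : P 0 = P' 0) (hnG : n (G * δ) = n' (G * δ))
    (hPG : P (G * δ) = P' (G * δ)) :
    ∑ k ∈ Finset.range G, (n (k * δ) - n' (k * δ)) ≤ n' (G * δ) - n' 0 := by
  have mem : ∀ k : ℕ, k ≤ G → (k : ℝ) * δ ∈ Set.Icc 0 V := fun k hk =>
    ⟨by positivity, le_trans (by gcongr) hG⟩
  -- Difference of the two utilities plus a correction: one step raises the first utility by at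
  -- least `δ * n` at the left point and the second by at most `δ * n'` at the right point. The term
  -- `δ * n'` moves the latter to the left point, so the sum telescopes.
  set f : ℕ → ℝ := fun k => ((k * δ) * n (k * δ) - P (k * δ))
    - ((k * δ) * n' (k * δ) - P' (k * δ)) + δ * n' (k * δ) with hf
  have step : ∀ k ∈ Finset.range G, δ * (n (k * δ) - n' (k * δ)) ≤ f (k + 1) - f k := by
    intro k hk
    have hk := Finset.mem_range.1 hk
    have m0 := mem k hk.le
    have m1 := mem (k + 1) hk
    have e1 := h _ m1 _ m0
    have e2 := h' _ m0 _ m1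
    simp only [hf]
    push_cast at e1 e2 ⊢
    nlinarith
  have key := Finset.sum_le_sum step
  rw [← Finset.mul_sum, Finset.sum_range_sub] at key
  simp only [hf, Nat.cast_zero, zero_mul, hn0, hP0, hnG, hPG] at key
  have : δ * ∑ k ∈ Finset.range G, (n (k * δ) - n' (k * δ)) ≤ δ * (n' (G * δ) - n' 0) := by
    linarith
  exact le_of_mul_le_mul_left this hδ

end SingleParameter

namespace OnlineMechanism

variable {N T : ℕ} {S : Type*} [MeasurableSpace S]

/-! ### Runs of the mechanism that differ in one user. -/

section Runs

variable (M : OnlineMechanism N S) (K : ℕ) (s : S)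

/-- The number of clicks on ad `i`. -/
noncomputable def totalClicks (b : Fin T → Fin N → ℝ) (ω : Fin T → User N) (i : Fin N) : ℝ :=
  ∑ t, if M.clicksAt K s b ω t i then 1 else 0

/-- The sum of the payments of ad `i`. -/
def totalPay (b : Fin T → Fin N → ℝ) (ω : Fin T → User N) (i : Fin N) : ℝ :=
  ∑ t, M.payAt K s b ω t i

lemma utility_eq (b : Fin T → Fin N → ℝ) (ω : Fin T → User N) (i : Fin N) (x : ℝ) :
    M.utility K s b ω i x = x * M.totalClicks K s b ω i - M.totalPay K s b ω i := by
  simp only [utility, totalClicks, totalPay, Finset.sum_sub_distrib, Finset.mul_sum, mul_ite,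
    mul_one, mul_zero]

lemma totalClicks_nonneg (b : Fin T → Fin N → ℝ) (ω : Fin T → User N) (i : Fin N) :
    0 ≤ M.totalClicks K s b ω i :=
  Finset.sum_nonneg fun t _ => by split_ifs <;> norm_num

lemma totalClicks_le (b : Fin T → Fin N → ℝ) (ω : Fin T → User N) (i : Fin N) :
    M.totalClicks K s b ω i ≤ T := by
  have : ∀ t ∈ Finset.univ, (if M.clicksAt K s b ω t i then 1 else 0 : ℝ) ≤ 1 :=
    fun t _ => by split_ifs <;> norm_num
  simpa [totalClicks] using Finset.sum_le_card_nsmul _ _ _ this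

lemma history_congr {b : Fin T → Fin N → ℝ} {ω ω' : Fin T → User N} :
    ∀ (t : ℕ) (ht : t ≤ T),
      (∀ τ : Fin T, (τ : ℕ) < t →
        clicks K (M.allocAt K s b ω τ) (ω τ) = clicks K (M.allocAt K s b ω τ) (ω' τ)) →
      M.history K s b ω t ht = M.history K s b ω' t ht
  | 0, _, _ => rfl
  | t + 1, ht, h => by
    have ih := history_congr t (Nat.le_of_succ_le ht) fun τ hτ => h τ (hτ.trans t.lt_succ_self)
    have h1 := h ⟨t, ht⟩ t.lt_succ_self
    simp only [allocAt] at h1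
    simp only [history, ← ih, h1]

/-- The users `ω` before round `t`, the user `u` in round `t`, and users who never click
afterwards. -/
def stopAfter (ω : Fin T → User N) (t : Fin T) (u : User N) (τ : Fin T) : User N :=
  if τ < t then ω τ else if τ = t then u else (fun _ => false, fun _ => true)

lemma history_stopAfter (b : Fin T → Fin N → ℝ) (ω : Fin T → User N) (t : Fin T) (u : User N)
    {τ : Fin T} (hτ : τ ≤ t) :
    M.history K s b (stopAfter ω t u) τ τ.2.le = M.history K s b ω τ τ.2.le := by
  refine history_congr M K s _ _ fun r hr => ?_
  have hrt : r < t := lt_of_lt_of_le (show r < τ from hr) hτ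
  simp [stopAfter, hrt]

lemma allocAt_stopAfter (b : Fin T → Fin N → ℝ) (ω : Fin T → User N) (t : Fin T) (u : User N)
    {τ : Fin T} (hτ : τ ≤ t) :
    M.allocAt K s b (stopAfter ω t u) τ = M.allocAt K s b ω τ := by
  simp only [allocAt, history_stopAfter M K s b ω t u hτ]

/-- Rounds before `t` coincide and later ones bring no click, so only round `t` counts, even if
later allocations differ. -/
lemma totalClicks_stopAfter (b : Fin T → Fin N → ℝ) (ω : Fin T → User N) (t : Fin T)
    (u u' : User N) (i : Fin N) :
    M.totalClicks K s b (stopAfter ω t u) i - M.totalClicks K s b (stopAfter ω t u') i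
      = (if clicks K (M.allocAt K s b ω t) u i then 1 else 0)
        - (if clicks K (M.allocAt K s b ω t) u' i then 1 else 0) := by
  unfold totalClicks
  rw [← Finset.sum_sub_distrib, Finset.sum_eq_single t]
  · simp only [clicksAt, allocAt_stopAfter M K s b ω t _ le_rfl]
    simp [stopAfter]
  · intro τ _ hτ
    rcases lt_or_gt_of_ne hτ with h | h
    · simp only [clicksAt, allocAt_stopAfter M K s b ω t _ h.le]
      simp [stopAfter, h]
    · simp [clicksAt, stopAfter, clicks, h.ne', h.not_gt]
  · simp

/-- Users enter the history and the payments only through clicks: equal clicks in round `t` make the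
whole runs indistinguishable. -/
lemma clicksAt_stopAfter_congr {b : Fin T → Fin N → ℝ} {ω : Fin T → User N} {t : Fin T}
    {u u' : User N}
    (h : clicks K (M.allocAt K s b ω t) u = clicks K (M.allocAt K s b ω t) u') :
    M.totalClicks K s b (stopAfter ω t u) = M.totalClicks K s b (stopAfter ω t u') ∧
      M.totalPay K s b (stopAfter ω t u) = M.totalPay K s b (stopAfter ω t u') := by
  have hc : ∀ τ : Fin T,
      clicks K (M.allocAt K s b (stopAfter ω t u) τ) (stopAfter ω t u τ)
        = clicks K (M.allocAt K s b (stopAfter ω t u) τ) (stopAfter ω t u' τ) := by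
    intro τ
    by_cases hτ : τ = t
    · subst hτ
      rw [allocAt_stopAfter M K s b ω τ _ le_rfl]
      simpa [stopAfter] using h
    · simp [stopAfter, hτ]
  have hh : ∀ τ : Fin T, M.history K s b (stopAfter ω t u) τ τ.2.le
      = M.history K s b (stopAfter ω t u') τ τ.2.le := fun τ =>
    history_congr M K s _ _ fun r _ => hc r
  have hcl : ∀ τ : Fin T, M.clicksAt K s b (stopAfter ω t u) τ
      = M.clicksAt K s b (stopAfter ω t u') τ := fun τ => by
    have := hc τ
    simp only [clicksAt, allocAt, hh] at this ⊢
    exact this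
  constructor
  · funext i
    simp only [totalClicks, hcl]
  · funext i
    simp only [totalPay, payAt, hcl, hh]

end Runs

/-! ### Measurability in the seed. -/

section Measurability

/-- Quantifying over predicates avoids a sigma-algebra on histories: the last round is absorbed into
`p`, by a finite union over its allocation. -/
lemma measurableSet_history (M : OnlineMechanism N S) (K : ℕ) (b : Fin T → Fin N → ℝ)
    (ω : Fin T → User N) :
    ∀ (t : ℕ) (ht : t ≤ T) (p : S → History N → Prop), (∀ h, MeasurableSet {s | p s h}) →
      MeasurableSet {s | p s (M.history K s b ω t ht)}
  | 0, _, p, hp => hp []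
  | t + 1, ht, p, hp => by
    refine measurableSet_history M K b ω t (Nat.le_of_succ_le ht)
      (fun s h => p s (h ++ [(b ⟨t, ht⟩, clicks K (M.alloc s h (b ⟨t, ht⟩)) (ω ⟨t, ht⟩))]))
      fun h => ?_
    have : {s | p s (h ++ [(b ⟨t, ht⟩, clicks K (M.alloc s h (b ⟨t, ht⟩)) (ω ⟨t, ht⟩))])}
        = ⋃ θ, {s | M.alloc s h (b ⟨t, ht⟩) = θ} ∩
            {s | p s (h ++ [(b ⟨t, ht⟩, clicks K θ (ω ⟨t, ht⟩))])} := by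
      ext s
      simp
    rw [this]
    exact MeasurableSet.iUnion fun θ => (M.measurableSet_alloc _ _ θ).inter (hp _)

lemma measurable_allocAt (M : OnlineMechanism N S) (K : ℕ) (b : Fin T → Fin N → ℝ)
    (ω : Fin T → User N) (t : Fin T) (f : Allocation N → ℝ) :
    Measurable fun s => f (M.allocAt K s b ω t) := by
  let _ : MeasurableSpace (Allocation N) := ⊤
  have h : Measurable fun s => M.allocAt K s b ω t :=
    measurable_to_countable' fun θ =>
      measurableSet_history M K b ω t t.2.le (fun s h => M.alloc s h (b t) = θ)
        fun h => M.measurableSet_alloc h (b t) θ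
  exact (measurable_from_top (f := f)).comp h

lemma integrable_socialWelfare (M : OnlineMechanism N S) (μ : MeasureTheory.Measure S)
    [MeasureTheory.IsProbabilityMeasure μ] (K : ℕ) (q c v : Fin N → ℝ)
    (b : Fin T → Fin N → ℝ) :
    MeasureTheory.Integrable (fun s => ∑ ω : Fin T → User N, userProb q c ω *
      ∑ t, socialWelfare K q c v (M.allocAt K s b ω t)) μ := by
  refine MeasureTheory.integrable_finsetSum _ fun ω _ => .const_mul ?_ _
  refine MeasureTheory.integrable_finsetSum _ fun t _ => ?_
  refine MeasureTheory.Integrable.of_bound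
    (C := ∑ θ, ‖socialWelfare K q c v θ‖)
    (measurable_allocAt M K b ω t _).aestronglyMeasurable (.of_forall fun s => ?_)
  exact Finset.single_le_sum (f := fun θ => ‖socialWelfare K q c v θ‖)
    (fun _ _ => norm_nonneg _) (Finset.mem_univ _)

end Measurability

/-! ### The upper bound, and averaging of regrets over value profiles. -/

lemma welfareRegret_le (M : OnlineMechanism N S) (μ : MeasureTheory.Measure S) {K : ℕ}
    {q c v : Fin N → ℝ} {V : ℝ} (hq : ∀ i, q i ∈ Set.Icc (0 : ℝ) 1)
    (hc : ∀ i, c i ∈ Set.Icc (0 : ℝ) 1) (hv : ∀ i, v i ∈ Set.Icc 0 V) :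
    M.welfareRegret μ K T q c v ≤ N * V * T := by
  have h1 : optWelfare K q c v ≤ N * V :=
    Finset.sup'_le _ _ fun θ _ => socialWelfare_le hq hc hv θ
  have h2 : 0 ≤ ∫ s, ∑ ω : Fin T → User N, userProb q c ω *
      ∑ t, socialWelfare K q c v (M.allocAt K s (fun _ => v) ω t) ∂μ :=
    MeasureTheory.integral_nonneg fun s => Finset.sum_nonneg fun ω _ =>
      mul_nonneg (userProb_nonneg hq hc ω) (Finset.sum_nonneg fun t _ =>
        socialWelfare_nonneg (fun i => (hq i).1) hc (fun i => (hv i).1) _)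
  have h3 : (T : ℝ) * optWelfare K q c v ≤ N * V * T := by
    rw [mul_comm]; gcongr
  unfold welfareRegret
  linarith

/-- If along every run a weighted count of lost welfare over a family of value profiles is at
least `L` in every round, the weighted sum of the regrets is at least `T * L`. -/
lemma le_sum_welfareRegret (M : OnlineMechanism N S) (μ : MeasureTheory.Measure S)
    [MeasureTheory.IsProbabilityMeasure μ] {K : ℕ} {q c : Fin N → ℝ}
    (hq : ∀ i, q i ∈ Set.Icc (0 : ℝ) 1) (hc : ∀ i, c i ∈ Set.Icc (0 : ℝ) 1)
    {ι : Type*} (A : Finset ι) (wt : ι → ℝ) (v : ι → Fin N → ℝ) (L : ℝ)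
    (h : ∀ (s : S) (ω : Fin T → User N) (t : Fin T),
      L ≤ ∑ k ∈ A, wt k * (optWelfare K q c (v k)
        - socialWelfare K q c (v k) (M.allocAt K s (fun _ => v k) ω t))) :
    T * L ≤ ∑ k ∈ A, wt k * M.welfareRegret μ K T q c (v k) := by
  set F : ι → S → ℝ := fun k s => ∑ ω : Fin T → User N, userProb q c ω *
    ∑ t, socialWelfare K q c (v k) (M.allocAt K s (fun _ => v k) ω t) with hF
  have hint : ∀ k, MeasureTheory.Integrable (F k) μ := fun k =>
    integrable_socialWelfare M μ K q c (v k) _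
  have hint' : ∀ k ∈ A,
      MeasureTheory.Integrable (fun s => wt k * (T * optWelfare K q c (v k) - F k s)) μ :=
    fun k _ => ((MeasureTheory.integrable_const _).sub (hint k)).const_mul _
  have hreg : ∑ k ∈ A, wt k * M.welfareRegret μ K T q c (v k)
      = ∫ s, ∑ k ∈ A, wt k * (T * optWelfare K q c (v k) - F k s) ∂μ := by
    rw [MeasureTheory.integral_finsetSum _ hint']
    refine Finset.sum_congr rfl fun k _ => ?_
    rw [MeasureTheory.integral_const_mul,
      MeasureTheory.integral_sub (MeasureTheory.integrable_const _) (hint k)]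
    simp [welfareRegret, hF]
  have hpt : ∀ s, T * L ≤ ∑ k ∈ A, wt k * (T * optWelfare K q c (v k) - F k s) := by
    intro s
    have e : ∀ k, T * optWelfare K q c (v k) - F k s
        = ∑ ω : Fin T → User N, userProb q c ω * ∑ t, (optWelfare K q c (v k)
          - socialWelfare K q c (v k) (M.allocAt K s (fun _ => v k) ω t)) := by
      intro k
      simp only [hF, Finset.sum_sub_distrib, mul_sub, Finset.sum_const, Finset.card_univ,
        Fintype.card_fin, nsmul_eq_mul, ← Finset.sum_mul, sum_userProb, one_mul]
    calc (T : ℝ) * L = ∑ ω : Fin T → User N, userProb q c ω * ∑ _t : Fin T, L := by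
          rw [← Finset.sum_mul, sum_userProb]; simp
      _ ≤ ∑ ω : Fin T → User N, userProb q c ω * ∑ t, ∑ k ∈ A, wt k * (optWelfare K q c (v k)
          - socialWelfare K q c (v k) (M.allocAt K s (fun _ => v k) ω t)) :=
          Finset.sum_le_sum fun ω _ => mul_le_mul_of_nonneg_left
            (Finset.sum_le_sum fun t _ => h s ω t) (userProb_nonneg hq hc ω)
      _ = ∑ k ∈ A, wt k * (T * optWelfare K q c (v k) - F k s) := by
          simp_rw [e, Finset.mul_sum]
          conv_rhs => rw [Finset.sum_comm]
          refine Finset.sum_congr rfl fun ω _ => ?_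
          rw [Finset.sum_comm]
          exact Finset.sum_congr rfl fun k _ => Finset.sum_congr rfl fun t _ => by ring
  rw [hreg]
  have := MeasureTheory.integral_mono (MeasureTheory.integrable_const (T * L : ℝ))
    (MeasureTheory.integrable_finsetSum _ hint') hpt
  simpa using this

end OnlineMechanism

/-! ### Probe users and the test profiles. -/

section Probe

variable {N : ℕ}

/-- A user who would click only ad `i`, and stops after the ads of `B`. -/
def probe (i : Fin N) (B : Finset (Fin N)) : User N :=
  (fun a => decide (a = i), fun a => decide (a ∉ B))

lemma clicks_probe (K : ℕ) (θ : Allocation N) (i : Fin N) (B : Finset (Fin N)) (a : Fin N) :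
    clicks K θ (probe i B) a = true ↔
      a = i ∧ (θ.symm i : ℕ) < K ∧ ∀ d ∈ B, ¬ θ.symm d < θ.symm i := by
  simp only [clicks, probe, decide_eq_true_eq]
  constructor
  · rintro ⟨h1, h2, rfl⟩
    exact ⟨rfl, h1, fun d hd hlt => h2 _ hlt (by simpa using hd)⟩
  · rintro ⟨rfl, h1, h2⟩
    exact ⟨h1, fun l hl hB => h2 _ hB (by simpa using hl), rfl⟩

lemma clicks_probe_mono (K : ℕ) (θ : Allocation N) (i : Fin N) {B B' : Finset (Fin N)}
    (h : B ⊆ B') (a : Fin N) (ha : clicks K θ (probe i B') a = true) :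
    clicks K θ (probe i B) a = true := by
  rw [clicks_probe] at ha ⊢
  exact ⟨ha.1, ha.2.1, fun d hd => ha.2.2 d (h hd)⟩

/-- There is no click at all: if `i` is displayed, `k` is above it and stops the user. -/
lemma clicks_probe_eq_of_below {K : ℕ} {w : Fin N → ℝ} {θ : Allocation N} (hθ : Sorts K w θ)
    {i k : Fin N} (hk : w i < w k) {B B' : Finset (Fin N)} (hB : k ∈ B) (hB' : k ∈ B') :
    clicks K θ (probe i B) = clicks K θ (probe i B') := by
  have h : ∀ B : Finset (Fin N), k ∈ B → ∀ a, clicks K θ (probe i B) a ≠ true := by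
    intro B hB a ha
    rw [clicks_probe] at ha
    exact ha.2.2 k hB (hθ k i hk ha.2.1)
  funext a
  rw [Bool.eq_false_of_not_eq_true (h B hB a), Bool.eq_false_of_not_eq_true (h B' hB' a)]

lemma clicks_probe_eq_of_top {K : ℕ} (hK : 0 < K) {w : Fin N → ℝ} {θ : Allocation N}
    (hθ : Sorts K w θ) {i : Fin N} (hi : ∀ d, d ≠ i → w d < w i) (B B' : Finset (Fin N)) :
    clicks K θ (probe i B) = clicks K θ (probe i B') := by
  have h0 : ∀ m : Fin N, (m : ℕ) < K → ¬ m < θ.symm i := by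
    intro m hm hlt
    have hne : θ m ≠ i := by rintro rfl; simp at hlt
    have := hθ i (θ m) (hi _ hne) (by simpa using hm)
    simp only [Equiv.symm_apply_apply] at this
    exact lt_asymm hlt this
  have hz : (θ.symm i : ℕ) = 0 := by
    by_contra hne
    exact h0 ⟨0, by omega⟩ hK (Nat.pos_of_ne_zero hne)
  funext a
  rw [Bool.eq_iff_iff, clicks_probe, clicks_probe]
  simp [Fin.lt_def, hz]

/-- Only `j` stands above `i`, so the click depends on whether the user stops after `j`. -/
lemma clicks_probe_second {K : ℕ} (hK : 2 ≤ K) {w : Fin N → ℝ} {θ : Allocation N}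
    (hθ : Sorts K w θ) {i j k : Fin N} (hjk : j ≠ k) (hik : i ≠ k) (hj : w i < w j)
    (hi : ∀ d, d ≠ i → d ≠ j → w d < w i) :
    clicks K θ (probe i {k}) i = true ∧ clicks K θ (probe i {k, j}) i ≠ true := by
  have h0 : ∀ m : Fin N, (m : ℕ) < K → m < θ.symm i → m = θ.symm j := by
    intro m hm hlt
    by_contra hmj
    have hne : θ m ≠ i := by rintro rfl; simp at hlt
    have hne' : θ m ≠ j := by rintro rfl; simp at hmj
    have := hθ i (θ m) (hi _ hne hne') (by simpa using hm)
    simp only [Equiv.symm_apply_apply] at this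
    exact lt_asymm hlt this
  -- Otherwise the two top slots, displayed since `2 ≤ K`, would both hold `j`.
  have hlt : (θ.symm i : ℕ) < 2 := by
    by_contra hge
    have hN := (θ.symm i).2
    have a0 := h0 ⟨0, by omega⟩ (by simp; omega) (by simp [Fin.lt_def]; omega)
    have a1 := h0 ⟨1, by omega⟩ (by simp; omega) (by simp [Fin.lt_def]; omega)
    simpa using a0.trans a1.symm
  have hdisp : (θ.symm i : ℕ) < K := by omega
  have hji := hθ j i hj hdisp
  constructor
  · rw [clicks_probe]
    refine ⟨rfl, hdisp, fun d hd hdi => ?_⟩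
    rw [Finset.mem_singleton.1 hd] at hdi
    exact hjk (θ.symm.injective (h0 _ (lt_trans hdi hdisp) hdi)).symm
  · rw [Ne, clicks_probe]
    exact fun h => h.2.2 j (by simp) hji

/-- Ad `i` has value `x`, and the weights of `j` and `k` are `4 * e` and `e`. -/
noncomputable def profile (q : Fin N → ℝ) (i j k : Fin N) (e x : ℝ) : Fin N → ℝ := fun a =>
  if a = i then x else if a = j then 4 * e / q j else if a = k then e / q k else 0

lemma update_profile (q : Fin N → ℝ) (i j k : Fin N) (e x y : ℝ) :
    Function.update (profile q i j k e x) i y = profile q i j k e y := by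
  funext a
  by_cases h : a = i
  · subst h; simp [profile]
  · simp [profile, h]

lemma mul_profile {q : Fin N → ℝ} (hq : ∀ a, 0 < q a) {i j k : Fin N} (e x : ℝ) (a : Fin N) :
    q a * profile q i j k e x a
      = if a = i then q i * x else if a = j then 4 * e else if a = k then e else 0 := by
  unfold profile
  split_ifs with h1 h2 h3
  · rw [h1]
  · rw [h2, mul_div_cancel₀ _ (hq j).ne']
  · rw [h3, mul_div_cancel₀ _ (hq k).ne']
  · simp

/-- Middle bids stay in `[2 * e, 3 * e]` to keep distance `e` from the weights `e` and `4 * e`. -/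
lemma profile_gap {q : Fin N → ℝ} (hq : ∀ a, 0 < q a) {i j k : Fin N} {e x : ℝ} (he : 0 < e)
    (hx : q i * x = 0 ∨ (2 * e ≤ q i * x ∧ q i * x ≤ 3 * e) ∨ q i * x = 5 * e) (a b : Fin N)
    (h : q b * profile q i j k e x b < q a * profile q i j k e x a) :
    e ≤ q a * profile q i j k e x a - q b * profile q i j k e x b := by
  rw [mul_profile hq, mul_profile hq] at h ⊢
  rcases hx with hx | hx | hx <;> split_ifs at h ⊢ <;> linarith

lemma profile_mem {q : Fin N → ℝ} {ρ V : ℝ} (hρ : 0 < ρ) (hV : 0 < V) (hq : ∀ a, ρ ≤ q a)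
    {i j k : Fin N} {x : ℝ} (hx : x ∈ Set.Icc 0 V) (a : Fin N) :
    profile q i j k (V * ρ / 5) x a ∈ Set.Icc 0 V := by
  have hpos : ∀ a, 0 < q a := fun a => hρ.trans_le (hq a)
  have hle : ∀ a, V * ρ ≤ V * q a := fun a => mul_le_mul_of_nonneg_left (hq a) hV.le
  have hp := mul_pos hV hρ
  unfold profile
  split_ifs
  · exact hx
  · exact ⟨div_nonneg (by linarith) (hpos j).le,
      (div_le_iff₀ (hpos j)).2 (by linarith [hle j])⟩
  · exact ⟨div_nonneg (by linarith) (hpos k).le,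
      (div_le_iff₀ (hpos k)).2 (by linarith [hle k])⟩
  · exact ⟨le_rfl, hV.le⟩

end Probe

/-! ### The linear lower bound. -/

namespace OnlineMechanism

variable {N T : ℕ} {S : Type*} [MeasurableSpace S]

open Classical in
/-- For a truthful mechanism, in every round: if ads are sorted by weight when `i` bids `0` and when
`i` bids the most, there are few bids in between for which they are sorted with `i` second. -/
lemma card_sorts_le (M : OnlineMechanism N S) {K : ℕ} (hK : 2 ≤ K) {V : ℝ}
    (hM : M.DSIC K T V) {q : Fin N → ℝ} (hq : ∀ a, 0 < q a) {i j k : Fin N} (hij : i ≠ j)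
    (hik : i ≠ k) (hjk : j ≠ k) {e : ℝ} (he : 0 < e) {m : ℕ} (hm : 0 < m)
    (hV : ∀ x ∈ Set.Icc 0 V, ∀ a, profile q i j k e x a ∈ Set.Icc 0 V)
    (heV : 5 * e / q i ≤ V) (s : S) (ω : Fin T → User N) (t : Fin T)
    (h0 : Sorts K (fun a => q a * profile q i j k e 0 a)
      (M.allocAt K s (fun _ => profile q i j k e 0) ω t))
    (h5 : Sorts K (fun a => q a * profile q i j k e (5 * e / q i) a)
      (M.allocAt K s (fun _ => profile q i j k e (5 * e / q i)) ω t)) :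
    ((Finset.Ico (2 * m) (3 * m)).filter fun r : ℕ =>
      Sorts K (fun a => q a * profile q i j k e (r * (e / (q i * m))) a)
        (M.allocAt K s (fun _ => profile q i j k e (r * (e / (q i * m)))) ω t)).card ≤ T := by
  have hm' : (0 : ℝ) < m := by exact_mod_cast hm
  have hqi := hq i
  -- One grid step adds `e / m` to the weight of `i`: index `5 * m` has weight `5 * e`, and indices
  -- in `[2 * m, 3 * m)` have weight in `[2 * e, 3 * e)`.
  set δ : ℝ := e / (q i * m) with hδ
  have hδ0 : 0 < δ := by positivity
  have hG : ((5 * m : ℕ) : ℝ) * δ = 5 * e / q i := by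
    rw [hδ]; push_cast; field_simp
  set n : Finset (Fin N) → ℝ → ℝ := fun B x =>
    M.totalClicks K s (fun _ : Fin T => profile q i j k e x) (stopAfter ω t (probe i B)) i with hn
  set P : Finset (Fin N) → ℝ → ℝ := fun B x =>
    M.totalPay K s (fun _ : Fin T => profile q i j k e x) (stopAfter ω t (probe i B)) i with hP
  have ic : ∀ B, ∀ x ∈ Set.Icc 0 V, ∀ y ∈ Set.Icc 0 V,
      x * n B y - P B y ≤ x * n B x - P B x := by
    intro B x hx y hy
    have := hM s (stopAfter ω t (probe i B)) i x hx (fun _ => profile q i j k e y)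
      (fun _ a => hV y hy a)
    simpa only [utility_eq, update_profile] using this
  have w : ∀ x a, q a * profile q i j k e x a
      = if a = i then q i * x else if a = j then 4 * e else if a = k then e else 0 :=
    fun x a => mul_profile hq e x a
  have wi : ∀ x, q i * profile q i j k e x i = q i * x := fun x => by simp [w]
  have c0 := M.clicksAt_stopAfter_congr K s (clicks_probe_eq_of_below h0 (i := i) (k := k)
    (by simp [w, hik.symm, hjk.symm, he]) (B := {k}) (B' := {k, j}) (by simp) (by simp))
  have c5 := M.clicksAt_stopAfter_congr K s (clicks_probe_eq_of_top (by omega) h5 (i := i)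
    (by
      intro d hd
      have : q i * (5 * e / q i) = 5 * e := by field_simp
      simp only [w, if_neg hd, if_true, this]
      split_ifs <;> linarith) {k} {k, j})
  have key := sum_sub_le_of_truthful (n := n {k}) (n' := n {k, j}) (P := P {k})
    (P' := P {k, j}) hδ0 (G := 5 * m) (hG.trans_le heV) (ic _) (ic _) (congrFun c0.1 i)
    (congrFun c0.2 i) (by rw [hG]; exact congrFun c5.1 i) (by rw [hG]; exact congrFun c5.2 i)
  have hdiff : ∀ x, n {k} x - n {k, j} x = _ := fun x =>
    M.totalClicks_stopAfter K s (fun _ => profile q i j k e x) ω t (probe i {k}) (probe i {k, j}) i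
  -- Fewer stopping ads can only add clicks, so grid points outside the middle range may be included
  -- in the sum.
  have hnonneg : ∀ x, 0 ≤ n {k} x - n {k, j} x := by
    intro x
    rw [hdiff]
    have := clicks_probe_mono K (M.allocAt K s (fun _ => profile q i j k e x) ω t) i
      (B := {k}) (B' := {k, j}) (by simp) i
    split_ifs <;> simp_all
  have hT : n {k, j} ((5 * m : ℕ) * δ) - n {k, j} 0 ≤ T := by
    have h1 := M.totalClicks_le K s (fun _ : Fin T => profile q i j k e ((5 * m : ℕ) * δ))
      (stopAfter ω t (probe i {k, j})) i
    have h2 := M.totalClicks_nonneg K s (fun _ : Fin T => profile q i j k e 0)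
      (stopAfter ω t (probe i {k, j})) i
    simp only [hn]
    linarith
  have hone : ∀ r ∈ (Finset.Ico (2 * m) (3 * m)).filter (fun r : ℕ =>
      Sorts K (fun a => q a * profile q i j k e (r * δ) a)
        (M.allocAt K s (fun _ => profile q i j k e (r * δ)) ω t)),
      (1 : ℝ) ≤ n {k} (r * δ) - n {k, j} (r * δ) := by
    intro r hr
    obtain ⟨hr1, hr2⟩ := Finset.mem_filter.1 hr
    rw [Finset.mem_Ico] at hr1
    have g1 : (2 * m : ℝ) ≤ r := by exact_mod_cast hr1.1
    have g2 : (r : ℝ) < 3 * m := by exact_mod_cast hr1.2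
    have hw : q i * (r * δ) = r / m * e := by rw [hδ]; field_simp
    have g3 : 2 ≤ (r : ℝ) / m := by rwa [le_div_iff₀ hm']
    have g4 : (r : ℝ) / m < 3 := by rwa [div_lt_iff₀ hm']
    have g5 : 2 * e ≤ q i * (r * δ) := by rw [hw]; gcongr
    have g6 : q i * (r * δ) < 3 * e := by rw [hw]; gcongr
    obtain ⟨p1, p2⟩ := clicks_probe_second hK hr2 (i := i) (j := j) (k := k) hjk hik
      (by simp only [w, if_true, if_neg hij.symm]; linarith)
      (by
        intro d hd hd'
        simp only [w, if_true, if_neg hd, if_neg hd']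
        split_ifs <;> linarith)
    rw [hdiff]
    simp [p1, p2]
  have hcard := Finset.card_nsmul_le_sum _ _ _ hone
  have hsub := Finset.sum_le_sum_of_subset_of_nonneg
    (f := fun r : ℕ => n {k} (r * δ) - n {k, j} (r * δ))
    (s := (Finset.Ico (2 * m) (3 * m)).filter (fun r : ℕ =>
      Sorts K (fun a => q a * profile q i j k e (r * δ) a)
        (M.allocAt K s (fun _ => profile q i j k e (r * δ)) ω t)))
    (t := Finset.range (5 * m)) (by
      intro r hr
      have := (Finset.mem_Ico.1 (Finset.mem_filter.1 hr).1).2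
      exact Finset.mem_range.2 (by omega)) fun r _ _ => hnonneg _
  simp only [nsmul_eq_mul, mul_one] at hcard
  exact_mod_cast (hcard.trans hsub).trans (key.trans hT)

open Classical in
/-- A truthful mechanism has linear regret for some values, when all the continuation
probabilities are `1 / 2`. -/
lemma exists_le_welfareRegret (M : OnlineMechanism N S) (μ : MeasureTheory.Measure S)
    [MeasureTheory.IsProbabilityMeasure μ] {K : ℕ} (hK : 2 ≤ K) {V ρ : ℝ} (hV : 0 < V)
    (hM : M.DSIC K T V) {q : Fin N → ℝ} (hρ : 0 < ρ) (hρq : ∀ a, ρ ≤ q a) (hq1 : ∀ a, q a ≤ 1)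
    {i j k : Fin N} (hij : i ≠ j) (hik : i ≠ k) (hjk : j ≠ k) :
    ∃ v : Fin N → ℝ, (∀ a, v a ∈ Set.Icc 0 V) ∧
      (1 / 2) ^ N * (V * ρ / 5) / 12 * T ≤ M.welfareRegret μ K T q (fun _ => 1 / 2) v := by
  have hq : ∀ a, 0 < q a := fun a => hρ.trans_le (hρq a)
  rcases Nat.eq_zero_or_pos T with rfl | hT
  · exact ⟨fun _ => 0, fun _ => ⟨le_rfl, hV.le⟩, by simp [welfareRegret]⟩
  have hT' : (0 : ℝ) < T := by exact_mod_cast hT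
  set e := V * ρ / 5 with he
  have he0 : 0 < e := by positivity
  set g : ℝ := (1 / 2) ^ N * e with hg
  have hg0 : 0 < g := by positivity
  -- At most `T` of the `m` middle bids can be sorted, so at least `T` fail.
  obtain ⟨m, hm⟩ : ∃ m, m = 2 * T := ⟨_, rfl⟩
  have hm0 : 0 < m := by omega
  have hm' : (0 : ℝ) < m := by exact_mod_cast hm0
  have hmT : (m : ℝ) = 2 * T := by rw [hm]; push_cast; ring
  have hqi := hq i
  have h5V : 5 * e / q i ≤ V := by
    rw [div_le_iff₀ hqi]
    have := mul_le_mul_of_nonneg_left (hρq i) hV.le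
    linarith
  set δ : ℝ := e / (q i * m) with hδ
  have hδ0 : 0 < δ := by positivity
  have hG : ((5 * m : ℕ) : ℝ) * δ = 5 * e / q i := by
    rw [hδ]; push_cast; field_simp
  have hw : ∀ r : ℕ, q i * (r * δ) = r / m * e := fun r => by rw [hδ]; field_simp
  set v : ℕ → Fin N → ℝ := fun r => profile q i j k e (r * δ) with hv
  have hmem : ∀ r ≤ 5 * m, ∀ a, v r a ∈ Set.Icc 0 V := fun r hr =>
    profile_mem hρ hV hρq ⟨by positivity, le_trans (by gcongr) (hG.trans_le h5V)⟩
  have hgap : ∀ r : ℕ, (r = 0 ∨ (2 * m ≤ r ∧ r < 3 * m) ∨ r = 5 * m) → ∀ θ,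
      ¬ Sorts K (fun a => q a * v r a) θ →
      g ≤ optWelfare K q (fun _ => 1 / 2) (v r) - socialWelfare K q (fun _ => 1 / 2) (v r) θ := by
    intro r hr θ hθ
    have := socialWelfare_add_le_optWelfare (K := K) (q := q) (v := v r)
      (profile_gap hq he0 (x := r * δ) ?_) hθ he0.le
    · linarith
    rw [hw]
    rcases hr with rfl | ⟨h2, h3⟩ | rfl
    · simp
    · right; left
      have g1 : (2 * m : ℝ) ≤ r := by exact_mod_cast h2
      have g2 : (r : ℝ) ≤ 3 * m := by exact_mod_cast h3.le
      have g3 : 2 ≤ (r : ℝ) / m := by rwa [le_div_iff₀ hm']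
      have g4 : (r : ℝ) / m ≤ 3 := by rwa [div_le_iff₀ hm']
      constructor <;> gcongr
    · right; right
      push_cast
      field_simp
  have hloss : ∀ r θ, 0 ≤ optWelfare K q (fun _ => 1 / 2) (v r)
      - socialWelfare K q (fun _ => 1 / 2) (v r) θ := fun r θ =>
    sub_nonneg.2 (socialWelfare_le_optWelfare K q _ (v r) θ)
  by_contra! hcon
  have hc : ∀ _ : Fin N, (1 / 2 : ℝ) ∈ Set.Icc (0 : ℝ) 1 := fun _ => by norm_num
  -- Each end gets weight `m`, so that failing at one end alone already costs `m * g ≥ T * g`.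
  have hsum : ∀ f : ℕ → ℝ,
      ∑ r ∈ insert 0 (insert (5 * m) (Finset.Ico (2 * m) (3 * m))),
        (if r ∈ Finset.Ico (2 * m) (3 * m) then 1 else (m : ℝ)) * f r
      = m * f 0 + (m * f (5 * m) + ∑ r ∈ Finset.Ico (2 * m) (3 * m), f r) := by
    intro f
    have n0 : 0 ∉ Finset.Ico (2 * m) (3 * m) := by simp [hm0.ne']
    have n5 : 5 * m ∉ Finset.Ico (2 * m) (3 * m) := by rw [Finset.mem_Ico]; omega
    rw [Finset.sum_insert (by simp only [Finset.mem_insert, Finset.mem_Ico]; omega),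
      Finset.sum_insert n5, if_neg n0, if_neg n5]
    congr 2
    exact Finset.sum_congr rfl fun r hr => by rw [if_pos hr, one_mul]
  have key := le_sum_welfareRegret (T := T) M μ (K := K) (c := fun _ => 1 / 2)
    (fun a => ⟨(hq a).le, hq1 a⟩) hc
    (insert 0 (insert (5 * m) (Finset.Ico (2 * m) (3 * m))))
    (fun r => if r ∈ Finset.Ico (2 * m) (3 * m) then 1 else m) v (T * g) (by
      intro s ω t
      rw [hsum fun r => optWelfare K q (fun _ => 1 / 2) (v r)
        - socialWelfare K q (fun _ => 1 / 2) (v r) (M.allocAt K s (fun _ => v r) ω t)]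
      have l0 := mul_nonneg hm'.le (hloss 0 (M.allocAt K s (fun _ => v 0) ω t))
      have l5 := mul_nonneg hm'.le (hloss (5 * m) (M.allocAt K s (fun _ => v (5 * m)) ω t))
      have lI := Finset.sum_nonneg fun r (_ : r ∈ Finset.Ico (2 * m) (3 * m)) =>
        hloss r (M.allocAt K s (fun _ => v r) ω t)
      have hTm : T * g ≤ m * g := by rw [hmT]; nlinarith
      by_cases h0 : Sorts K (fun a => q a * v 0 a) (M.allocAt K s (fun _ => v 0) ω t)
      swap
      · have := mul_le_mul_of_nonneg_left (hgap 0 (by simp) _ h0) hm'.le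
        linarith
      by_cases h5 : Sorts K (fun a => q a * v (5 * m) a)
        (M.allocAt K s (fun _ => v (5 * m)) ω t)
      swap
      · have := mul_le_mul_of_nonneg_left (hgap (5 * m) (by simp) _ h5) hm'.le
        linarith
      simp only [hv, hG, Nat.cast_zero, zero_mul] at h0 h5
      have hcard := M.card_sorts_le hK hM hq hij hik hjk he0 hm0
        (fun x hx => profile_mem hρ hV hρq hx) h5V s ω t h0 h5
      have hadd := Finset.card_filter_add_card_filter_not (s := Finset.Ico (2 * m) (3 * m))
        fun r : ℕ => Sorts K (fun a => q a * v r a) (M.allocAt K s (fun _ => v r) ω t)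
      rw [Nat.card_Ico] at hadd
      have hbad : T ≤ ((Finset.Ico (2 * m) (3 * m)).filter fun r : ℕ =>
          ¬ Sorts K (fun a => q a * v r a) (M.allocAt K s (fun _ => v r) ω t)).card := by
        simp only [hv] at hadd ⊢
        rw [← hδ] at hcard
        omega
      have hlow : (T : ℝ) * g ≤ ∑ r ∈ Finset.Ico (2 * m) (3 * m),
          (optWelfare K q (fun _ => 1 / 2) (v r)
            - socialWelfare K q (fun _ => 1 / 2) (v r) (M.allocAt K s (fun _ => v r) ω t)) := by
        refine le_trans ?_ (Finset.sum_le_sum_of_subset_of_nonneg (Finset.filter_subset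
          (fun r : ℕ => ¬ Sorts K (fun a => q a * v r a)
            (M.allocAt K s (fun _ => v r) ω t)) _) fun r _ _ => hloss r _)
        refine le_trans ?_ (Finset.card_nsmul_le_sum _ _ g fun r hr => ?_)
        · rw [nsmul_eq_mul]
          gcongr
        · obtain ⟨hr1, hr2⟩ := Finset.mem_filter.1 hr
          exact hgap r (Or.inr (Or.inl (Finset.mem_Ico.1 hr1))) _ hr2
      linarith)
  rw [hsum fun r => M.welfareRegret μ K T q (fun _ => 1 / 2) (v r)] at key
  have r0 := mul_le_mul_of_nonneg_left (hcon _ (hmem 0 (by omega))).le hm'.le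
  have r5 := mul_lt_mul_of_pos_left (hcon _ (hmem (5 * m) le_rfl)) hm'
  have rI := Finset.sum_le_card_nsmul (Finset.Ico (2 * m) (3 * m))
    (fun r => M.welfareRegret μ K T q (fun _ => 1 / 2) (v r)) (g / 12 * T) fun r hr =>
      (hcon _ (hmem r (by have := (Finset.mem_Ico.1 hr).2; omega))).le
  rw [Nat.card_Ico, nsmul_eq_mul, show 3 * m - 2 * m = m by omega] at rI
  rw [hmT] at *
  -- The total weight is `3 * m = 6 * T`, so regrets below `g / 12 * T` sum to less than `T * T * g
  -- / 2`, against the lower bound `T * (T * g)`.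
  nlinarith [mul_pos (mul_pos hT' hT') hg0]

end OnlineMechanism

end SponsoredSearch

theorem mainTheorem5 (N K : ℕ) (hK : 2 ≤ K) (hKN : K < N) (V : ℝ) (hV : 0 < V)
    (q : Fin N → ℝ) (hq : ∀ i, q i ∈ Set.Ioc 0 1) :
    ∃ κ C : ℝ, 0 < κ ∧ 0 < C ∧
      ∀ (T : ℕ) (S : Type*) [MeasurableSpace S] (μ : MeasureTheory.Measure S)
        [MeasureTheory.IsProbabilityMeasure μ] (M : SponsoredSearch.OnlineMechanism N S),
        M.DSIC K T V →
          (∃ c v : Fin N → ℝ, (∀ i, c i ∈ Set.Icc 0 1) ∧ (∀ i, v i ∈ Set.Icc 0 V) ∧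
            κ * T ≤ M.welfareRegret μ K T q c v) ∧
          (∀ c v : Fin N → ℝ, (∀ i, c i ∈ Set.Icc 0 1) → (∀ i, v i ∈ Set.Icc 0 V) →
            M.welfareRegret μ K T q c v ≤ C * T) := by
  -- The least quality serves as `ρ`; the three ads `i`, `j`, `k` exist because `2 ≤ K < N`.
  obtain ⟨i₀, -, hmin⟩ := Finset.exists_min_image Finset.univ q ⟨⟨0, by omega⟩, Finset.mem_univ _⟩
  have hρ : 0 < q i₀ := (hq i₀).1
  refine ⟨(1 / 2) ^ N * (V * q i₀ / 5) / 12, N * V, by positivity,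
    mul_pos (by exact_mod_cast (show 0 < N by omega)) hV, ?_⟩
  intro T S _ μ _ M hM
  constructor
  · obtain ⟨v, hv, h⟩ := M.exists_le_welfareRegret μ hK hV hM hρ
      (fun a => hmin a (Finset.mem_univ a)) (fun a => (hq a).2)
      (i := ⟨0, by omega⟩) (j := ⟨1, by omega⟩) (k := ⟨2, by omega⟩) (by simp) (by simp) (by simp)
    exact ⟨fun _ => 1 / 2, v, fun _ => by norm_num, hv, h⟩
  · intro c v hc hv
    exact M.welfareRegret_le μ (fun i => ⟨(hq i).1.le, (hq i).2⟩) hc hv
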